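/- **Setting.** Let $\Omega\subset\mathbb R^n$ be a bounded Lipschitz domain, partitioned into a finite collection $\mathcal T_h$ of non-overlapping Lipschitz subdomains $K$. For a domain $K$ let $L^2\Lambda(K)$ be the square-integrable differential forms of all degrees, $H\Lambda(K)$ and $H^*\Lambda(K)$ those with $\mathrm dw\in L^2\Lambda(K)$, respectively $\delta w\in L^2\Lambda(K)$, and $\mathrm D=\mathrm d+\delta$. Let $w^{\mathrm{tan}}$ be the pullback of $w$ to $\partial K$ and $w^{\mathrm{nor}}=\widehat\star^{-1}\operatorname{tr}\star w$ (in the weak sense), so that $\langle w_1^{\mathrm{tan}},w_2^{\mathrm{nor}}\rangle_{\partial K}=(\mathrm dw_1,w_2)_K-(w_1,\delta w_2)_K$. Choose subspaces $W_h(K)\subset H\Lambda(K)\cap H^*\Lambda(K)$, all of whose elements have tangential and normal traces in $L^2\Lambda(\partial K)$, and subspaces $\widehat W_h^{\mathrm{nor}}(\partial K),\widehat W_h^{\mathrm{tan}}(\partial K)\subset L^2\Lambda(\partial K)$. Let $W_h,\widehat W_h^{\mathrm{nor}},\widehat W_h^{\mathrm{tan}}$ be the products over $K\in\mathcal T_h$;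 let $\widehat V_h^{\mathrm{tan}}\subset\widehat W_h^{\mathrm{tan}}$ consist of the elements whose values from the two sides of each interior facet agree, and $\mathring{\widehat V}{}_h^{\mathrm{tan}}$ of those elements of $\widehat V_h^{\mathrm{tan}}$ that also vanish on $\partial\Omega$. Bold letters denote the corresponding spaces of $\mathbb R^2$-valued forms (tensor products with $\mathbb R^2$), $\mathbf J(q,p)=(-p,q)$, operators act componentwise, and $$[\mathbf a,\mathbf b]_{\partial K}=\langle\mathbf a^{\mathrm{tan}},\mathbf b^{\mathrm{nor}}\rangle_{\partial K}-\langle\mathbf b^{\mathrm{tan}},\mathbf a^{\mathrm{nor}}\rangle_{\partial K}.$$ Let $\mathbf\Phi=\prod_K\mathbf\Phi_K$ be a local flux function, with bounded linear maps $\mathbf\Phi_K\colon\mathbf W_h(K)\times\widehat{\mathbf W}{}_h^{\mathrm{nor}}(\partial K)\times\widehat{\mathbf W}{}_h^{\mathrm{tan}}(\partial K)\to\mathbf L^2\mathbf\Lambda(\partial K)$, where $\mathbf W_h(K)$ carries the graph norm (which controls $\mathbf w$, $\mathbf d\mathbf w$, $\boldsymbol\delta\mathbf w$ and both traces in $L^2$).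 Let $I$ be a time interval and $\mathbf f=\prod_K\mathbf f_K$, $\mathbf f_K\colon I\times\mathbf W_h(K)\to\mathbf L^2\mathbf\Lambda(K)$, be $C^1$ in its second argument. The semidiscretization seeks $\mathbf z_h\colon I\to\mathbf W_h$ and $\widehat{\mathbf z}_h=(\widehat{\mathbf z}_h^{\mathrm{nor}},\widehat{\mathbf z}_h^{\mathrm{tan}})\colon I\to\widehat{\mathbf W}{}_h^{\mathrm{nor}}\times\widehat{\mathbf V}{}_h^{\mathrm{tan}}$ with, at each $t\in I$, $$\begin{aligned} \text{(a)}\quad&(\mathbf J\dot{\mathbf z}_h,\mathbf w_h)_{\mathcal T_h}+(\mathbf z_h,\mathbf D\mathbf w_h)_{\mathcal T_h}+[\widehat{\mathbf z}_h,\mathbf w_h]_{\partial\mathcal T_h}=(\mathbf f(t,\mathbf z_h),\mathbf w_h)_{\mathcal T_h}&&\forall\,\mathbf w_h\in\mathbf W_h,\\ \text{(b)}\quad&\langle\mathbf\Phi(\mathbf z_h,\widehat{\mathbf z}_h),\widehat{\mathbf w}_h^{\mathrm{nor}}\rangle_{\partial\mathcal T_h}=0&&\forall\,\widehat{\mathbf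 w}_h^{\mathrm{nor}}\in\widehat{\mathbf W}{}_h^{\mathrm{nor}},\\ \text{(c)}\quad&\langle\widehat{\mathbf z}_h^{\mathrm{nor}},\widehat{\mathbf w}_h^{\mathrm{tan}}\rangle_{\partial\mathcal T_h}=0&&\forall\,\widehat{\mathbf w}_h^{\mathrm{tan}}\in\mathring{\widehat{\mathbf V}}{}_h^{\mathrm{tan}}, \end{aligned}$$ where pairings over $\mathcal T_h$ and $\partial\mathcal T_h$ are sums over the elements. A first variation $(\mathbf w_i,\widehat{\mathbf w}_i)$ of a solution takes values in the same spaces and solves the same system with $\frac{\partial\mathbf f}{\partial\mathbf z_h}(t,\mathbf z_h)\mathbf w_i$ in place of $\mathbf f(t,\mathbf z_h)$. **Definitions.** The flux $\mathbf\Phi$ is *multisymplectic* if $[\widehat{\mathbf w}_1-\mathbf w_1,\widehat{\mathbf w}_2-\mathbf w_2]_{\partial K}=0$ for all $K\in\mathcal T_h$ whenever $(\mathbf w_i,\widehat{\mathbf w}_i)\in\mathbf W_h\times(\widehat{\mathbf W}{}_h^{\mathrm{nor}}\times\widehat{\mathbf V}{}_h^{\mathrm{tan}})$, $i=1,2$,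 satisfy (b). It is *strongly conservative* if (b) and (c) imply that $\widehat{\mathbf z}_h^{\mathrm{nor}}$ is single-valued, i.e. $\widehat{\mathbf z}_h^{\mathrm{nor}}|_{e^+}+\widehat{\mathbf z}_h^{\mathrm{nor}}|_{e^-}=0$ on every interior facet $e=\partial K^+\cap\partial K^-$. **Theorem.** If $\mathbf\Phi$ is strongly conservative and multisymplectic, then the semidiscretization is *strongly multisymplectic*: for every solution $(\mathbf z_h,\widehat{\mathbf z}_h)$ of (a)–(c) along which $\partial\mathbf f/\partial\mathbf z_h$ is symmetric, all first variations $(\mathbf w_1,\widehat{\mathbf w}_1)$, $(\mathbf w_2,\widehat{\mathbf w}_2)$ of it, and every collection of elements $\mathcal K\subset\mathcal T_h$, $$\frac{\mathrm d}{\mathrm dt}(\mathbf J\mathbf w_1,\mathbf w_2)_{\mathcal K}+[\widehat{\mathbf w}_1,\widehat{\mathbf w}_2]_{\partial(\overline{\bigcup\mathcal K})}=0\qquad\text{on }I,$$ where the bracket on $\partial(\overline{\bigcup\mathcal K})$ uses, on the part of it belonging to $\partial K$ with $K\in\mathcal K$, the numerical traces from $K$. -/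

import Mathlib

open MeasureTheory Set
open scoped RealInnerProductSpace ContDiff

noncomputable section

namespace FEEC

/-! ### Exterior algebra of Euclidean space, in coordinates -/

/-- Euclidean `n`-space. -/
abbrev E (n : ℕ) : Type := EuclideanSpace ℝ (Fin n)

/-- The exterior algebra `Alt ℝⁿ = ⨁ₖ Altᵏ ℝⁿ` with its Euclidean inner product: the form
`∑_I ω_I dx^I` is given by its coefficients `ω_I`, where `I` runs over all subsets
`{i₁ < ⋯ < iₖ}` of the coordinates and `dx^I = dx^{i₁} ∧ ⋯ ∧ dx^{iₖ}`. The `dx^I` are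
orthonormal. -/
abbrev Alt (n : ℕ) : Type := EuclideanSpace ℝ (Finset (Fin n))

/-- The sign of moving `dx^j` past the `dx^i` with `i ∈ I`, `i < j`. -/
def sgn {n : ℕ} (j : Fin n) (I : Finset (Fin n)) : ℝ := (-1) ^ (I.filter (· < j)).card

/-- `ω ↦ dx^j ∧ ω`. -/
def wedgeBasis {n : ℕ} (j : Fin n) : Alt n →ₗ[ℝ] Alt n where
  toFun u := WithLp.toLp 2 fun I => if j ∈ I then sgn j I * u (I.erase j) else 0
  map_add' u v := by
    ext I; by_cases h : j ∈ I <;> simp [h, mul_add]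
  map_smul' c u := by
    ext I; by_cases h : j ∈ I <;> simp [h, mul_left_comm]

/-- `ω ↦ ι_{e_j} ω`, the interior product (contraction in the first slot) with the basis
vector `e_j`. -/
def contractBasis {n : ℕ} (j : Fin n) : Alt n →ₗ[ℝ] Alt n where
  toFun u := WithLp.toLp 2 fun I => if j ∈ I then 0 else sgn j I * u (insert j I)
  map_add' u v := by
    ext I; by_cases h : j ∈ I <;> simp [h, mul_add]
  map_smul' c u := by
    ext I; by_cases h : j ∈ I <;> simp [h, mul_left_comm]

/-- `ω ↦ ν♭ ∧ ω`, where `ν♭ = ∑ⱼ νⱼ dx^j`. -/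
def wedge {n : ℕ} (ν : E n) : Alt n →ₗ[ℝ] Alt n := ∑ j, ν j • wedgeBasis j

/-- `ω ↦ ι_ν ω`, the interior product with the vector `ν`. -/
def contract {n : ℕ} (ν : E n) : Alt n →ₗ[ℝ] Alt n := ∑ j, ν j • contractBasis j

/-- For a unit vector `ν`, `ω ↦ ι_ν (ν♭ ∧ ω) = ω - ν♭ ∧ ι_ν ω` is the pullback of `ω` to the
hyperplane `ν^⊥`. A form on the hyperplane `ν^⊥` is identified, through the orthogonal projection
`ℝⁿ → ν^⊥`, with an element of `Alt ℝⁿ` that is fixed by this map. For `ν = 0` the map vanishes. -/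
def tangentialPart {n : ℕ} (ν : E n) : Alt n →ₗ[ℝ] Alt n := contract ν ∘ₗ wedge ν

/-! ### Smooth forms, exterior differential and codifferential -/

/-- Smooth compactly supported differential forms (of mixed degree) on `ℝⁿ`. -/
def SmoothForm (n : ℕ) : Submodule ℝ (E n → Alt n) where
  carrier := {u | ContDiff ℝ ∞ u ∧ HasCompactSupport u}
  add_mem' hu hv := ⟨hu.1.add hv.1, hu.2.add hv.2⟩
  zero_mem' := ⟨contDiff_const, HasCompactSupport.zero⟩
  smul_mem' c _ hu := ⟨contDiff_const.smul hu.1, hu.2.smul_left (f := fun _ => c)⟩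

/-- The first-order operator `u ↦ ∑ⱼ A_j (∂ⱼ u)` with constant coefficients `A_j`. -/
def firstOrder {n : ℕ} (A : Fin n → Alt n →ₗ[ℝ] Alt n) : SmoothForm n →ₗ[ℝ] SmoothForm n where
  toFun u := ⟨fun x => ∑ j, A j (fderiv ℝ u.1 x (EuclideanSpace.single j 1)), by
    constructor
    · refine ContDiff.sum fun j _ => ?_
      refine (LinearMap.toContinuousLinearMap (A j)).contDiff.comp ?_
      exact (u.2.1.fderiv_right (m := ∞) (by simp)).clm_apply contDiff_const
    · refine (u.2.2.fderiv (𝕜 := ℝ)).mono ?_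
      intro x hx
      rw [Function.mem_support] at hx ⊢
      intro h
      apply hx
      simp [h]⟩
  map_add' u v := by
    ext1
    funext x
    have hu : DifferentiableAt ℝ u.1 x := u.2.1.differentiable (by simp) x
    have hv : DifferentiableAt ℝ v.1 x := v.2.1.differentiable (by simp) x
    simp [fderiv_add hu hv, Finset.sum_add_distrib]
  map_smul' c u := by
    ext1
    funext x
    have hu : DifferentiableAt ℝ u.1 x := u.2.1.differentiable (by simp) x
    simp [fderiv_const_smul hu, Finset.smul_sum]

/-- The exterior differential `d u = ∑ⱼ dx^j ∧ ∂ⱼ u`. -/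
def extD {n : ℕ} : SmoothForm n →ₗ[ℝ] SmoothForm n := firstOrder wedgeBasis

/-- The codifferential `δ u = - ∑ⱼ ι_{e_j} ∂ⱼ u`, which is the formal adjoint of `d`. -/
def coD {n : ℕ} : SmoothForm n →ₗ[ℝ] SmoothForm n := - firstOrder contractBasis

/-! ### Lipschitz domains and their boundaries -/

/-- A bounded Lipschitz domain (connectedness is not required): a nonempty bounded open set that,
near each of its boundary points, is the strict epigraph of a Lipschitz function over the
hyperplane orthogonal to some unit vector `e`. -/
structure IsLipschitzDomain {n : ℕ} (K : Set (E n)) : Prop where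
  isOpen : IsOpen K
  nonempty : K.Nonempty
  isBounded : Bornology.IsBounded K
  isEpigraph : ∀ x ∈ frontier K, ∃ e : E n, ‖e‖ = 1 ∧ ∃ (L : NNReal) (φ : E n → ℝ),
    LipschitzWith L φ ∧ ∃ r > 0, ∀ y ∈ Metric.ball x r, y ∈ K ↔ φ (y - ⟪e, y⟫ • e) < ⟪e, y⟫

/-- `ν` is the outward unit normal to `K` at `x`: it is a unit vector, and every closed cone at `x`
that opens in the direction `-ν` (respectively `ν`) with half-angle less than a right angle lies
inside (respectively outside) `K` near `x`, up to its vertex. -/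
def IsOuterNormal {n : ℕ} (K : Set (E n)) (x ν : E n) : Prop :=
  ‖ν‖ = 1 ∧ ∀ ε > 0, ∃ r > 0, ∀ y ∈ Metric.ball x r, y ≠ x →
    (⟪y - x, ν⟫ ≤ -ε * ‖y - x‖ → y ∈ K) ∧ (ε * ‖y - x‖ ≤ ⟪y - x, ν⟫ → y ∉ K)

open Classical in
/-- The outward unit normal to `K`, which exists (and is unique) at almost every boundary point of a
Lipschitz domain; it is set to zero at the other points. -/
def outerNormal {n : ℕ} (K : Set (E n)) (x : E n) : E n :=
  if h : ∃ ν, IsOuterNormal K x ν then h.choose else 0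

/-- Surface measure on the boundary of `K`: the `(n-1)`-dimensional Hausdorff measure, with the
normalization that makes it agree with Lebesgue measure on hyperplanes. -/
def surface {n : ℕ} (K : Set (E n)) : Measure (E n) := (μHE[n - 1]).restrict (frontier K)

/-! ### Square-integrable forms on a domain and on its boundary -/

/-- `L²Λ(K)`. -/
abbrev L2 {n : ℕ} (K : Set (E n)) : Type := Lp (Alt n) 2 (volume.restrict K)

/-- `L²Λ(∂K)`: the square-integrable sections of the exterior algebra of the tangent hyperplanes to
`∂K`, identified with elements of `Alt ℝⁿ` as for `tangentialPart`. -/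
def BdryL2 {n : ℕ} (K : Set (E n)) : Submodule ℝ (Lp (Alt n) 2 (surface K)) where
  carrier := {g | ∀ᵐ x ∂(surface K), tangentialPart (outerNormal K x) (g x) = g x}
  add_mem' := by
    intro a b ha hb
    filter_upwards [ha, hb, Lp.coeFn_add a b] with x h1 h2 h3
    rw [h3, Pi.add_apply, map_add, h1, h2]
  zero_mem' := by
    filter_upwards [Lp.coeFn_zero (Alt n) 2 (surface K)] with x h
    rw [h, Pi.zero_apply, map_zero]
  smul_mem' := by
    intro c a ha
    filter_upwards [ha, Lp.coeFn_smul c a] with x h1 h2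
    rw [h2, Pi.smul_apply, map_smul, h1]

theorem SmoothForm.memLp {n : ℕ} (u : SmoothForm n) (K : Set (E n)) :
    MemLp u.1 2 (volume.restrict K) :=
  (u.2.1.continuous.memLp_of_hasCompactSupport u.2.2).restrict K

/-- The restriction of a smooth form to `K`, as an element of `L²Λ(K)`. -/
def SmoothForm.toL2 {n : ℕ} (K : Set (E n)) : SmoothForm n →ₗ[ℝ] L2 K where
  toFun u := (SmoothForm.memLp u K).toLp u.1
  map_add' _ _ := rfl
  map_smul' _ _ := rfl

/-! ### Weak differentials and traces -/

/-- `a = d w` on `K` in the sense of distributions. -/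
def IsWeakD {n : ℕ} (K : Set (E n)) (w a : L2 K) : Prop :=
  ∀ u : SmoothForm n, tsupport u.1 ⊆ K →
    ⟪a, SmoothForm.toL2 K u⟫ = ⟪w, SmoothForm.toL2 K (coD u)⟫

/-- `b = δ w` on `K` in the sense of distributions. -/
def IsWeakDelta {n : ℕ} (K : Set (E n)) (w b : L2 K) : Prop :=
  ∀ u : SmoothForm n, tsupport u.1 ⊆ K →
    ⟪b, SmoothForm.toL2 K u⟫ = ⟪w, SmoothForm.toL2 K (extD u)⟫

/-- The triples `(u, d u, u^tan)` for forms `u` on `K` that are smooth up to the boundary. Here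
`u^tan` is the pullback of `u` to `∂K`. -/
def smoothTangential {n : ℕ} (K : Set (E n)) : Submodule ℝ (L2 K × L2 K × BdryL2 K) where
  carrier := {p | ∃ u : SmoothForm n, p.1 = SmoothForm.toL2 K u ∧
    p.2.1 = SmoothForm.toL2 K (extD u) ∧
    ∀ᵐ x ∂(surface K), p.2.2.1 x = tangentialPart (outerNormal K x) (u.1 x)}
  add_mem' := by
    rintro p q ⟨u, hu1, hu2, hu3⟩ ⟨v, hv1, hv2, hv3⟩
    refine ⟨u + v, by simp [hu1, hv1], by simp [hu2, hv2], ?_⟩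
    filter_upwards [hu3, hv3, Lp.coeFn_add p.2.2.1 q.2.2.1] with x h1 h2 h3
    have : (p + q).2.2.1 x = (p.2.2.1 + q.2.2.1) x := rfl
    rw [this, Submodule.coe_add, h3, Pi.add_apply, h1, h2]
    exact (map_add _ _ _).symm
  zero_mem' := by
    refine ⟨0, by simp, by simp, ?_⟩
    filter_upwards [Lp.coeFn_zero (Alt n) 2 (surface K)] with x h
    have : (0 : L2 K × L2 K × BdryL2 K).2.2.1 x = (0 : Lp (Alt n) 2 (surface K)) x := rfl
    rw [this, h, Submodule.coe_zero, Pi.zero_apply]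
    exact (map_zero _).symm
  smul_mem' := by
    rintro c p ⟨u, hu1, hu2, hu3⟩
    refine ⟨c • u, by simp [hu1], by simp [hu2], ?_⟩
    filter_upwards [hu3, Lp.coeFn_smul c p.2.2.1] with x h1 h2
    have : (c • p).2.2.1 x = (c • p.2.2.1) x := rfl
    rw [this, Submodule.coe_smul, h2, Pi.smul_apply, h1]
    exact (map_smul _ _ _).symm

/-- `w` is a form in `HΛ(K)` with `d w = a`, and its weak tangential trace is the square-integrable
form `g`. The trace extends the pullback of smooth forms by closure: there are smooth forms `u_j`
with `u_j → w` and `d u_j → a` in `L²Λ(K)` and `u_j^tan → g` in `L²Λ(∂K)`. -/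
def HasTanTrace {n : ℕ} (K : Set (E n)) (w a : L2 K) (g : BdryL2 K) : Prop :=
  IsWeakD K w a ∧ (w, a, g) ∈ (smoothTangential K).topologicalClosure

/-- `v` is a form in `H*Λ(K)` with `δ v = b`, and its weak normal trace is the square-integrable
form `h`. The trace is defined by integration by parts against smooth forms,
`⟨u^tan, v^nor⟩_∂K = (d u, v)_K - (u, δ v)_K`; for `v` smooth up to the boundary it is `ι_ν v`, which
is `⋆̂⁻¹ tr ⋆ v`. -/
def HasNorTrace {n : ℕ} (K : Set (E n)) (v b : L2 K) (h : BdryL2 K) : Prop :=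
  IsWeakDelta K v b ∧ ∀ p ∈ smoothTangential K, ⟪p.2.2, h⟫ = ⟪p.2.1, v⟫ - ⟪p.1, b⟫

/-- The ambient space of the tuples `(w, d w, δ w, w^nor, w^tan)`. -/
def GraphSpace {n : ℕ} (K : Set (E n)) : Type := L2 K × L2 K × L2 K × BdryL2 K × BdryL2 K

instance {n : ℕ} (K : Set (E n)) : NormedAddCommGroup (GraphSpace K) :=
  inferInstanceAs (NormedAddCommGroup (L2 K × L2 K × L2 K × BdryL2 K × BdryL2 K))

instance {n : ℕ} (K : Set (E n)) : NormedSpace ℝ (GraphSpace K) :=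
  inferInstanceAs (NormedSpace ℝ (L2 K × L2 K × L2 K × BdryL2 K × BdryL2 K))

namespace GraphSpace

variable {n : ℕ} {K : Set (E n)}

/-- The entry `w`. -/
def form : GraphSpace K →L[ℝ] L2 K :=
  ContinuousLinearMap.fst ℝ (L2 K) (L2 K × L2 K × BdryL2 K × BdryL2 K)

/-- The entry `d w`. -/
def d : GraphSpace K →L[ℝ] L2 K :=
  (ContinuousLinearMap.fst ℝ (L2 K) (L2 K × BdryL2 K × BdryL2 K)).comp
    (ContinuousLinearMap.snd ℝ (L2 K) (L2 K × L2 K × BdryL2 K × BdryL2 K))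

/-- The entry `δ w`. -/
def δ : GraphSpace K →L[ℝ] L2 K :=
  (ContinuousLinearMap.fst ℝ (L2 K) (BdryL2 K × BdryL2 K)).comp
    ((ContinuousLinearMap.snd ℝ (L2 K) (L2 K × BdryL2 K × BdryL2 K)).comp
      (ContinuousLinearMap.snd ℝ (L2 K) (L2 K × L2 K × BdryL2 K × BdryL2 K)))

/-- The pair of entries `(w^nor, w^tan)`. -/
def norTan : GraphSpace K →L[ℝ] BdryL2 K × BdryL2 K :=
  (ContinuousLinearMap.snd ℝ (L2 K) (BdryL2 K × BdryL2 K)).comp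
    ((ContinuousLinearMap.snd ℝ (L2 K) (L2 K × BdryL2 K × BdryL2 K)).comp
      (ContinuousLinearMap.snd ℝ (L2 K) (L2 K × L2 K × BdryL2 K × BdryL2 K)))

/-- The entry `w^nor`. -/
def nor : GraphSpace K →L[ℝ] BdryL2 K := (ContinuousLinearMap.fst ℝ _ _).comp norTan

/-- The entry `w^tan`. -/
def tan : GraphSpace K →L[ℝ] BdryL2 K := (ContinuousLinearMap.snd ℝ _ _).comp norTan

end GraphSpace

/-- The space of all `w ∈ HΛ(K) ∩ H*Λ(K)` whose tangential and normal traces are square-integrable,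
with its graph norm. Such a `w` is stored as the tuple `(w, d w, δ w, w^nor, w^tan)`, the last four
entries of which are determined by the first. -/
def TraceForms {n : ℕ} (K : Set (E n)) : Submodule ℝ (GraphSpace K) where
  carrier := {w | HasTanTrace K (GraphSpace.form w) (GraphSpace.d w) (GraphSpace.tan w) ∧
    HasNorTrace K (GraphSpace.form w) (GraphSpace.δ w) (GraphSpace.nor w)}
  add_mem' := by
    rintro p q ⟨⟨h1, h2⟩, h3, h4⟩ ⟨⟨k1, k2⟩, k3, k4⟩
    refine ⟨⟨fun u hu => ?_, ?_⟩, fun u hu => ?_, fun s hs => ?_⟩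
    · simp only [map_add, inner_add_left, h1 u hu, k1 u hu]
    · simp only [map_add]
      exact Submodule.add_mem _ h2 k2
    · simp only [map_add, inner_add_left, h3 u hu, k3 u hu]
    · simp only [map_add, inner_add_right, h4 s hs, k4 s hs]; ring
  zero_mem' := by
    refine ⟨⟨fun u hu => ?_, ?_⟩, fun u hu => ?_, fun s hs => ?_⟩
    · simp only [map_zero, inner_zero_left]
    · simp only [map_zero]
      exact Submodule.zero_mem _
    · simp only [map_zero, inner_zero_left]
    · simp only [map_zero, inner_zero_right, sub_zero]
  smul_mem' := by
    rintro c p ⟨⟨h1, h2⟩, h3, h4⟩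
    refine ⟨⟨fun u hu => ?_, ?_⟩, fun u hu => ?_, fun s hs => ?_⟩
    · simp only [map_smul, inner_smul_left, h1 u hu]
    · simp only [map_smul]
      exact Submodule.smul_mem _ c h2
    · simp only [map_smul, inner_smul_left, h3 u hu]
    · have h5 : ⟪s.2.2, c • GraphSpace.nor p⟫ = c * ⟪s.2.2, GraphSpace.nor p⟫ :=
        inner_smul_right s.2.2 (GraphSpace.nor p) c
      rw [map_smul, map_smul, map_smul, h5, inner_smul_right, inner_smul_right, h4 s hs]; ring

/-! ### `ℝ²`-valued forms -/

/-- `V ⊗ ℝ²`, as pairs `(q, p)`. -/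
abbrev Bold (V : Type*) : Type _ := V × V

/-- The inner product on `V ⊗ ℝ²`. -/
def ip {V : Type*} [NormedAddCommGroup V] [InnerProductSpace ℝ V] (a b : Bold V) : ℝ :=
  ⟪a.1, b.1⟫ + ⟪a.2, b.2⟫

/-- `𝐉 (q, p) = (-p, q)`. -/
def J {V : Type*} [AddCommGroup V] (z : Bold V) : Bold V := (-z.2, z.1)

/-- The underlying square-integrable `ℝ²`-valued form. -/
def val {n : ℕ} {K : Set (E n)} {W : Submodule ℝ (TraceForms K)} (w : Bold W) : Bold (L2 K) :=
  (GraphSpace.form w.1.1.1, GraphSpace.form w.2.1.1)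

/-- The Hodge–Dirac operator `𝐃 w = 𝐝 w + 𝛅 w`, componentwise. -/
def dirac {n : ℕ} {K : Set (E n)} {W : Submodule ℝ (TraceForms K)} (w : Bold W) : Bold (L2 K) :=
  (GraphSpace.d w.1.1.1 + GraphSpace.δ w.1.1.1, GraphSpace.d w.2.1.1 + GraphSpace.δ w.2.1.1)

/-- A pair `(nor, tan)` of a normal and a tangential trace, both square-integrable `ℝ²`-valued forms
on the boundary. -/
abbrev BdryTraces {n : ℕ} (K : Set (E n)) : Type := Bold (BdryL2 K) × Bold (BdryL2 K)

/-- The normal and tangential traces of a form. -/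
def traces {n : ℕ} {K : Set (E n)} {W : Submodule ℝ (TraceForms K)} (w : Bold W) : BdryTraces K :=
  ((GraphSpace.nor w.1.1.1, GraphSpace.nor w.2.1.1), (GraphSpace.tan w.1.1.1, GraphSpace.tan w.2.1.1))

/-- `[a, b]_∂K = ⟨a^tan, b^nor⟩_∂K - ⟨b^tan, a^nor⟩_∂K`. -/
def bracket {n : ℕ} {K : Set (E n)} (a b : BdryTraces K) : ℝ := ip a.2 b.1 - ip b.2 a.1

/-- The integrand of `bracket`, at a point of the boundary. -/
def bracketDensity {n : ℕ} {K : Set (E n)} (a b : BdryTraces K) (x : E n) : ℝ :=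
  (⟪a.2.1.1 x, b.1.1.1 x⟫ + ⟪a.2.2.1 x, b.1.2.1 x⟫)
    - (⟪b.2.1.1 x, a.1.1.1 x⟫ + ⟪b.2.2.1 x, a.1.2.1 x⟫)

/-! ### Hybrid semidiscretization -/

/-- A partition `𝒯_h = {K i}` of a bounded Lipschitz domain `Ω` into non-overlapping Lipschitz
subdomains, with a choice of broken spaces `W_h(K)`, `Ŵ_h^nor(∂K)`, `Ŵ_h^tan(∂K)`. -/
structure HybridSpaces (n : ℕ) (ι : Type*) where
  Ω : Set (E n)
  lipschitz : IsLipschitzDomain Ω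
  K : ι → Set (E n)
  lipschitz_elem : ∀ i, IsLipschitzDomain (K i)
  subset : ∀ i, K i ⊆ Ω
  disjoint : ∀ i j, i ≠ j → Disjoint (K i) (K j)
  cover : closure Ω = ⋃ i, closure (K i)
  W : ∀ i, Submodule ℝ (TraceForms (K i))
  Wnor : ∀ i, Submodule ℝ (BdryL2 (K i))
  Wtan : ∀ i, Submodule ℝ (BdryL2 (K i))

namespace HybridSpaces

variable {n : ℕ} {ι : Type*} (T : HybridSpaces n ι)

/-- `𝐖_h = ∏ 𝐖_h(K)`. -/
abbrev BW : Type _ := ∀ i, Bold (T.W i)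

/-- `Ŵ_h^nor ⊗ ℝ²`. -/
abbrev BWnor : Type _ := ∀ i, Bold (T.Wnor i)

/-- `Ŵ_h^tan ⊗ ℝ²`. -/
abbrev BWtan : Type _ := ∀ i, Bold (T.Wtan i)

/-- The surface measure on `∂K⁺ ∩ ∂K⁻`. -/
def facet (i j : ι) : Measure (E n) := (μHE[n - 1]).restrict (frontier (T.K i) ∩ frontier (T.K j))

/-- Membership in `V̂_h^tan ⊗ ℝ²`: the tangential jump vanishes on every interior facet. -/
def TanSingleValued (v : T.BWtan) : Prop :=
  ∀ i j, i ≠ j → ∀ᵐ x ∂(T.facet i j),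
    (v i).1.1.1 x = (v j).1.1.1 x ∧ (v i).2.1.1 x = (v j).2.1.1 x

/-- Membership in `V̊_h^tan ⊗ ℝ²` (with the hat): the tangential jump vanishes on every interior
facet and on `∂Ω`, where by convention the jump is the value. -/
def TanSingleValuedZero (v : T.BWtan) : Prop :=
  T.TanSingleValued v ∧
  ∀ i, ∀ᵐ x ∂((μHE[n - 1]).restrict (frontier (T.K i) ∩ frontier T.Ω)),
    (v i).1.1.1 x = 0 ∧ (v i).2.1.1 x = 0

/-- The normal jump vanishes on every interior facet: `v|_{e⁺} + v|_{e⁻} = 0`. -/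
def NorSingleValued (v : T.BWnor) : Prop :=
  ∀ i j, i ≠ j → ∀ᵐ x ∂(T.facet i j),
    (v i).1.1.1 x + (v j).1.1.1 x = 0 ∧ (v i).2.1.1 x + (v j).2.1.1 x = 0

/-- A pair `(w, ŵ)` of a broken form `w ∈ 𝐖_h` and numerical traces `ŵ = (ŵ^nor, ŵ^tan)` in
`𝐖̂_h^nor × 𝐕̂_h^tan`. -/
structure State where
  form : T.BW
  nor : T.BWnor
  tan : T.BWtan
  single : T.TanSingleValued tan

variable {T}

/-- A broken normal trace, seen in `L²Λ(∂K) ⊗ ℝ²` on each element. -/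
def norVal (v : T.BWnor) (i : ι) : Bold (BdryL2 (T.K i)) := ((v i).1.1, (v i).2.1)

/-- A broken tangential trace, seen in `L²Λ(∂K) ⊗ ℝ²` on each element. -/
def tanVal (v : T.BWtan) (i : ι) : Bold (BdryL2 (T.K i)) := ((v i).1.1, (v i).2.1)

/-- The numerical traces `ŵ` on `∂K`. -/
def State.hat (s : T.State) (i : ι) : BdryTraces (T.K i) := (norVal s.nor i, tanVal s.tan i)

variable (T)

/-- A local flux function `𝚽 = ∏ 𝚽_K`, each `𝚽_K` bounded and linear. -/
abbrev Flux : Type _ :=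
  ∀ i, Bold (T.W i) × Bold (T.Wnor i) × Bold (T.Wtan i) →L[ℝ] Bold (BdryL2 (T.K i))

/-- A local source term `𝐟 = ∏ 𝐟_K`, with `𝐟_K (t, z)` in `L²Λ(K) ⊗ ℝ²`. -/
abbrev Source : Type _ := ∀ i, ℝ → Bold (T.W i) → Bold (L2 (T.K i))

variable {T} [Fintype ι]

/-- The flux equation: `⟨𝚽(w, ŵ), v^nor⟩_{∂𝒯_h} = 0` for all `v^nor` in `𝐖̂_h^nor`. -/
def FluxEq (Φ : T.Flux) (s : T.State) : Prop :=
  ∀ v : T.BWnor, ∑ i, ip (Φ i (s.form i, s.nor i, s.tan i)) (norVal v i) = 0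

/-- The conservativity equation: `⟨ŵ^nor, v^tan⟩_{∂𝒯_h} = 0` for all single-valued `v^tan` that
vanish on `∂Ω`. -/
def ConsEq (s : T.State) : Prop :=
  ∀ v : T.BWtan, T.TanSingleValuedZero v → ∑ i, ip (norVal s.nor i) (tanVal v i) = 0

/-- The dynamical equation at a time at which `w` has time derivative `w'`, with right-hand side `F`:
`(𝐉 w', v)_{𝒯_h} + (w, 𝐃 v)_{𝒯_h} + [ŵ, v]_{∂𝒯_h} = (F, v)_{𝒯_h}` for all `v ∈ 𝐖_h`. -/
def DynEq (s : T.State) (w' F : ∀ i, Bold (L2 (T.K i))) : Prop :=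
  ∀ v : T.BW, ∑ i, ip (J (w' i)) (val (v i)) + ∑ i, ip (val (s.form i)) (dirac (v i))
    + ∑ i, bracket (s.hat i) (traces (v i)) = ∑ i, ip (F i) (val (v i))

/-- On the time interval `I`, the family of states `s` is differentiable in time as a curve of
square-integrable forms and satisfies the weak problem with right-hand side `F`. -/
def SolvesWeak (I : Set ℝ) (Φ : T.Flux) (F : ∀ i, ℝ → Bold (L2 (T.K i))) (s : ℝ → T.State) :
    Prop :=
  ∀ t ∈ I, (∃ w' : ∀ i, Bold (L2 (T.K i)),
      (∀ i, HasDerivWithinAt (fun τ => val ((s τ).form i)) (w' i) I t) ∧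
      DynEq (s t) w' (fun i => F i t)) ∧
    FluxEq Φ (s t) ∧ ConsEq (s t)

/-- `(z, ẑ)` is a solution of the semidiscretized system, with source `𝐟(t, z)`. -/
def IsSolution (I : Set ℝ) (f : T.Source) (Φ : T.Flux) (z : ℝ → T.State) : Prop :=
  SolvesWeak I Φ (fun i t => f i t ((z t).form i)) z

/-- `(w, ŵ)` is a first variation of `(z, ẑ)`: it solves the linearized problem, with right-hand side
`(∂𝐟/∂z)(t, z) w`. -/
def IsFirstVariation (I : Set ℝ) (f : T.Source) (Φ : T.Flux) (z w : ℝ → T.State) : Prop :=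
  SolvesWeak I Φ (fun i t => fderiv ℝ (f i t) ((z t).form i) ((w t).form i)) w


/-- `∂𝐟/∂z` is symmetric along `z`. -/
def SymmetricAlong (I : Set ℝ) (f : T.Source) (z : ℝ → T.State) : Prop :=
  ∀ t ∈ I, ∀ i, ∀ v w : Bold (T.W i),
    ip (fderiv ℝ (f i t) ((z t).form i) v) (val w) = ip (val v) (fderiv ℝ (f i t) ((z t).form i) w)

/-- The flux is multisymplectic: `[ŵ₁ - w₁, ŵ₂ - w₂]_∂K = 0` on every element, for all `(w₁, ŵ₁)` and
`(w₂, ŵ₂)` that satisfy the flux equation. -/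
def FluxMultisymplectic (Φ : T.Flux) : Prop :=
  ∀ s₁ s₂ : T.State, FluxEq Φ s₁ → FluxEq Φ s₂ →
    ∀ i, bracket (s₁.hat i - traces (s₁.form i)) (s₂.hat i - traces (s₂.form i)) = 0

/-- The flux is strongly conservative: the flux and conservativity equations imply that the numerical
normal traces are single-valued. -/
def StronglyConservative (Φ : T.Flux) : Prop :=
  ∀ s : T.State, FluxEq Φ s → ConsEq s → T.NorSingleValued s.nor

/-- The closure of the union of a collection of elements. -/
def region (T : HybridSpaces n ι) (𝒦 : Finset ι) : Set (E n) := closure (⋃ i ∈ 𝒦, T.K i)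

/-- `[ŵ₁, ŵ₂]` on the boundary of the region covered by the elements of `𝒦`. The part of this boundary
that belongs to `∂K`, `K ∈ 𝒦`, carries the numerical traces from `K`; these parts overlap in null
sets only. -/
def regionBracket (𝒦 : Finset ι) (s₁ s₂ : T.State) : ℝ :=
  ∑ i ∈ 𝒦, ∫ x in frontier (T.region 𝒦) ∩ frontier (T.K i),
    bracketDensity (s₁.hat i) (s₂.hat i) x ∂μHE[n - 1]

/-- The semidiscretization is strongly multisymplectic: for every solution along which `∂𝐟/∂z` is
symmetric and all first variations of it, every collection `𝒦` of elements satisfies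
`d/dt (𝐉 w₁, w₂)_𝒦 + [ŵ₁, ŵ₂] = 0`, with the bracket on the boundary of the region that `𝒦` covers. -/
def StronglyMultisymplectic (I : Set ℝ) (f : T.Source) (Φ : T.Flux) : Prop :=
  ∀ z w₁ w₂ : ℝ → T.State, IsSolution I f Φ z → SymmetricAlong I f z →
    IsFirstVariation I f Φ z w₁ → IsFirstVariation I f Φ z w₂ →
    ∀ 𝒦 : Finset ι, ∀ t ∈ I,
      HasDerivWithinAt
        (fun τ => ∑ i ∈ 𝒦, ip (J (val ((w₁ τ).form i))) (val ((w₂ τ).form i)))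
        (- regionBracket 𝒦 (w₁ t) (w₂ t)) I t

end HybridSpaces

end FEEC

end

namespace FEEC

/-! ### Outer normals of Lipschitz domains -/

/-! The proof combines a conservation law on each element with cancellation across interfaces.

On one element, the equation for each first variation is tested with the other one. Subtracting
removes the source by symmetry of its derivative, and integration by parts (`bracket_traces`) turns
the Dirac terms into `[w₁, w₂]`. What remains, `[w₁, w₂] - [ŵ₁, w₂] - [w₁, ŵ₂]`, equals `-[ŵ₁, ŵ₂]`
because the flux is multisymplectic; this is `hasDerivWithinAt_elem`.

In the sum over `𝒦`, the integrands from the two sides of an interface cancel: tangential traces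
agree and, by strong conservativity, normal traces are opposite. It must still be shown that, up to
null sets, the part of `∂K` off the boundary of the region is the disjoint union of the interfaces
with other elements of `𝒦`. By Rademacher's theorem almost every boundary point has outer normals,
and disjoint sets with normals at a common point have opposite ones. Three vectors cannot be
pairwise opposite, so almost nowhere do three elements meet, or two elements and the complement of
`Ω`. This gives `mem_frontier_diff_iff` and `sum_bracket_eq_regionBracket`. -/

theorem IsOuterNormal.compl {n : ℕ} {K : Set (E n)} {x ν : E n} (h : IsOuterNormal K x ν) :
    IsOuterNormal Kᶜ x (-ν) := by
  refine ⟨by rw [norm_neg]; exact h.1, fun ε hε => ?_⟩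
  obtain ⟨r, hr, H⟩ := h.2 ε hε
  refine ⟨r, hr, fun y hy hne => ?_⟩
  obtain ⟨h1, h2⟩ := H y hy hne
  rw [inner_neg_right]
  refine ⟨fun h => h2 (by linarith), fun h => ?_⟩
  rw [notMem_compl_iff]
  exact h1 (by linarith)

theorem IsOuterNormal.exists_mem {n : ℕ} {K : Set (E n)} {x ν v : E n} (h : IsOuterNormal K x ν)
    (hv : ⟪v, ν⟫ < 0) : ∃ t₀ > (0 : ℝ), ∀ t, 0 < t → t < t₀ → x + t • v ∈ K := by
  have hv0 : v ≠ 0 := by rintro rfl; simp at hv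
  have hn : 0 < ‖v‖ := norm_pos_iff.2 hv0
  -- With this aperture the ray in direction `v` lies exactly on the boundary of the closed inner
  -- cone.
  obtain ⟨r, hr, H⟩ := h.2 (-⟪v, ν⟫ / ‖v‖) (div_pos (by linarith) hn)
  refine ⟨r / ‖v‖, div_pos hr hn, fun t ht htr => ?_⟩
  have hnt : ‖t • v‖ = t * ‖v‖ := by rw [norm_smul, Real.norm_of_nonneg ht.le]
  refine (H (x + t • v) ?_ ?_).1 ?_
  · rw [Metric.mem_ball, dist_eq_norm, add_sub_cancel_left, hnt]
    exact (lt_div_iff₀ hn).1 htr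
  · simp [ht.ne', hv0]
  · rw [add_sub_cancel_left, hnt, real_inner_smul_left]
    apply le_of_eq
    field_simp

/-- Disjoint sets have opposite normals. -/
theorem IsOuterNormal.eq_neg_of_disjoint {n : ℕ} {A B : Set (E n)} {x ν μ : E n}
    (hA : IsOuterNormal A x ν) (hB : IsOuterNormal B x μ) (hAB : Disjoint A B) : μ = -ν := by
  by_contra hne
  have hlt : -1 < ⟪ν, μ⟫ := by
    have h1 : 0 < ‖ν + μ‖ := norm_pos_iff.2 fun h => hne (eq_neg_of_add_eq_zero_right h)
    have h2 := norm_add_sq_real ν μ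
    rw [hA.1, hB.1] at h2
    nlinarith
  -- The direction `-(ν + μ)` has inner product `-1 - ⟪ν, μ⟫ < 0` with both normals, so a short
  -- segment along it enters both sets.
  obtain ⟨t₁, ht₁, h₁⟩ := hA.exists_mem (v := -(ν + μ)) (by
    rw [inner_neg_left, inner_add_left, real_inner_self_eq_norm_sq, hA.1, real_inner_comm]
    linarith)
  obtain ⟨t₂, ht₂, h₂⟩ := hB.exists_mem (v := -(ν + μ)) (by
    rw [inner_neg_left, inner_add_left, real_inner_self_eq_norm_sq, hB.1]
    linarith)
  have hpos : 0 < min t₁ t₂ := lt_min ht₁ ht₂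
  have hl : min t₁ t₂ / 2 < min t₁ t₂ := half_lt_self hpos
  exact hAB.le_bot ⟨h₁ _ (half_pos hpos) (hl.trans_le (min_le_left _ _)),
    h₂ _ (half_pos hpos) (hl.trans_le (min_le_right _ _))⟩

theorem IsOuterNormal.ne_neg {n : ℕ} {K : Set (E n)} {x ν : E n} (h : IsOuterNormal K x ν) :
    ν ≠ -ν := by
  intro h'
  have h0 : (2 : ℝ) • ν = 0 := by
    rw [two_smul]
    exact add_eq_zero_iff_eq_neg.2 h'
  have h1 := h.1
  rw [(smul_eq_zero.1 h0).resolve_left two_ne_zero, norm_zero] at h1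
  exact zero_ne_one h1

/-- The normalizing factor between `μHE[d]` and Hausdorff measure is nonzero, so both have the same
null sets. -/
theorem _root_.LipschitzWith.euclideanHausdorffMeasure_image_null {X Y : Type*} [MetricSpace X]
    [MeasurableSpace X] [BorelSpace X] [MetricSpace Y] [MeasurableSpace Y] [BorelSpace Y]
    {C : NNReal} {f : X → Y} (hf : LipschitzWith C f) {d : ℕ} {s : Set X}
    (hs : (μHE[d] : Measure X) s = 0) : (μHE[d] : Measure Y) (f '' s) = 0 := by
  rw [Measure.euclideanHausdorffMeasure_def, Measure.smul_apply] at hs ⊢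
  have h0 := (smul_eq_zero.1 hs).resolve_left
    (Measure.addHaarScalarFactor_volume_hausdorffMeasure_ne_zero d)
  have := hf.hausdorffMeasure_image_le (d := d) (Nat.cast_nonneg d) s
  rw [h0, mul_zero] at this
  rw [le_antisymm this bot_le, smul_zero]

/-- A sublevel set of a function that is differentiable at a point of its boundary, with nonzero
gradient, has an outer normal there. -/
theorem exists_isOuterNormal_of_hasFDerivAt {n : ℕ} {K : Set (E n)} {F : E n → ℝ}
    {F' : E n →L[ℝ] ℝ} {x : E n} (hF : HasFDerivAt F F' x) (hx : F x = 0) (hF' : F' ≠ 0)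
    (hK : ∀ᶠ y in nhds x, y ∈ K ↔ F y < 0) : ∃ ν, IsOuterNormal K x ν := by
  set g : E n := (InnerProductSpace.toDual ℝ (E n)).symm F' with hg
  have hgF : ∀ v, F' v = ⟪g, v⟫ := fun v => (InnerProductSpace.toDual_symm_apply).symm
  have hg0 : g ≠ 0 := by simpa [hg] using hF'
  have hgn : 0 < ‖g‖ := norm_pos_iff.2 hg0
  refine ⟨‖g‖⁻¹ • g, by rw [norm_smul, norm_inv, norm_norm, inv_mul_cancel₀ hgn.ne'],
    fun ε hε => ?_⟩
  -- On the cones of aperture `ε` the linear part has size at least `ε * ‖g‖ * ‖y - x‖`. An error of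
  -- at most half of that leaves the sign of `F` unchanged.
  have hsmall := hF.isLittleO.def (c := ε * ‖g‖ / 2) (by positivity)
  obtain ⟨r, hr, H⟩ := Metric.eventually_nhds_iff_ball.1 (hsmall.and hK)
  refine ⟨r, hr, fun y hy hne => ?_⟩
  obtain ⟨h1, h2⟩ := H y hy
  rw [hx, sub_zero, hgF, Real.norm_eq_abs, abs_le] at h1
  have hpos : 0 < ε * ‖g‖ * ‖y - x‖ := by
    have := norm_pos_iff.2 (sub_ne_zero.2 hne)
    positivity
  have hin : ⟪y - x, ‖g‖⁻¹ • g⟫ = ‖g‖⁻¹ * ⟪g, y - x⟫ := by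
    rw [real_inner_smul_right, real_inner_comm]
  rw [h2, hin, inv_mul_eq_div, div_le_iff₀ hgn, le_div_iff₀ hgn]
  exact ⟨fun h => by linarith [h1.2], fun h => by linarith [h1.1]⟩

/-- A Lipschitz domain has an outer normal at almost every point of its boundary. -/
theorem IsLipschitzDomain.ae_exists_isOuterNormal {n : ℕ} {K : Set (E n)}
    (hK : IsLipschitzDomain K) :
    ∀ᵐ x ∂(μHE[n - 1] : Measure (E n)), x ∈ frontier K → ∃ ν, IsOuterNormal K x ν := by
  rw [ae_iff]
  refine measure_null_of_locally_null _ fun x hx => ?_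
  simp only [mem_ofPred_eq, Classical.not_imp] at hx
  obtain ⟨e, he, L, φ, hφ, r, hr, hepi⟩ := hK.isEpigraph x hx.1
  have he0 : e ≠ 0 := by rintro rfl; simp at he
  let H : Submodule ℝ (E n) := (Submodule.span ℝ {e})ᗮ
  -- The nonzero vector `e` forces `n ≥ 1`, so the subtraction is not truncated.
  have hdim : Module.finrank ℝ H = n - 1 := by
    have h1 := Submodule.finrank_add_finrank_orthogonal (Submodule.span ℝ {e})
    rw [finrank_span_singleton he0, finrank_euclideanSpace_fin] at h1
    change Module.finrank ℝ (Submodule.span ℝ {e})ᗮ = n - 1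
    omega
  let Q : E n →L[ℝ] E n := ContinuousLinearMap.id ℝ (E n) - (innerSL ℝ e).smulRight e
  have hQ : ∀ y, Q y = y - ⟪e, y⟫ • e := fun y => rfl
  have hQH : ∀ y, Q y ∈ H := fun y => by
    rw [Submodule.mem_orthogonal_singleton_iff_inner_right, hQ, inner_sub_right,
      real_inner_smul_right, real_inner_self_eq_norm_sq, he]
    ring
  let P : E n →L[ℝ] H := Q.codRestrict H hQH
  let ψ : H → ℝ := fun h => φ h
  have hψ : LipschitzWith L ψ := by
    have h := hφ.comp (LipschitzWith.subtype_val (H : Set (E n)))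
    rw [mul_one] at h
    exact h
  let G : H → E n := fun h => h + ψ h • e
  have hG : LipschitzWith (1 + L * ‖e‖₊) G := by
    refine (LipschitzWith.subtype_val (H : Set (E n))).add ?_
    refine LipschitzWith.of_dist_le_mul fun a b => ?_
    rw [dist_eq_norm, ← sub_smul, norm_smul, ← dist_eq_norm, NNReal.coe_mul, coe_nnnorm]
    nlinarith [hψ.dist_le_mul a b, norm_nonneg e]
  -- Rademacher's theorem is applied on the hyperplane, where `μHE` in its own dimension is a Haar
  -- measure. The Lipschitz graph map `G` then carries the exceptional set to a null set of the
  -- boundary.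
  have hnull : (μHE[n - 1] : Measure H) {h | ¬ DifferentiableAt ℝ ψ h} = 0 := by
    rw [← hdim]
    exact hψ.ae_differentiableAt
  refine ⟨_, Filter.inter_mem self_mem_nhdsWithin
    (mem_nhdsWithin_of_mem_nhds (Metric.ball_mem_nhds x hr)), measure_mono_null ?_
    (hG.euclideanHausdorffMeasure_image_null hnull)⟩
  rintro y ⟨hy, hyr⟩
  simp only [mem_ofPred_eq, Classical.not_imp] at hy
  have hφc : Continuous fun z : E n => φ (z - ⟪e, z⟫ • e) := hφ.continuous.comp (by fun_prop)
  have hec : Continuous fun z : E n => ⟪e, z⟫ := by fun_prop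
  -- One inequality passes to the closure of the epigraph; the other holds because the open set `K`
  -- omits its frontier.
  have hyφ : φ (y - ⟪e, y⟫ • e) = ⟪e, y⟫ := by
    apply le_antisymm
    · have hcl : y ∈ closure (Metric.ball x r ∩ K) :=
        Metric.isOpen_ball.inter_closure ⟨hyr, frontier_subset_closure hy.1⟩
      refine (isClosed_le hφc hec).closure_subset_iff.2 ?_ hcl
      exact fun z hz => ((hepi z hz.1).1 hz.2).le
    · have hyK : y ∉ K := by
        have := hy.1
        rw [hK.isOpen.frontier_eq] at this
        exact this.2
      exact not_lt.1 fun h => hyK ((hepi y hyr).2 h)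
  refine ⟨P y, fun hdiff => hy.2 ?_, ?_⟩
  · have hF := (hdiff.hasFDerivAt.comp y P.hasFDerivAt).sub (innerSL ℝ e).hasFDerivAt
    refine exists_isOuterNormal_of_hasFDerivAt hF ?_ ?_ ?_
    · exact sub_eq_zero.2 hyφ
    -- The projection kills `e`, so the derivative of the defining function along `e` is `-1`.
    · intro h0
      have h1 := congrArg (fun A => A e) h0
      have hPe : P e = 0 := by
        apply Subtype.ext
        change Q e = 0
        rw [hQ, real_inner_self_eq_norm_sq, he]
        simp
      simp [hPe, he] at h1
    · filter_upwards [Metric.isOpen_ball.mem_nhds hyr] with z hz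
      rw [hepi z hz]
      exact sub_neg.symm
  · change Q y + φ (Q y) • e = y
    rw [hQ, hyφ]
    abel

/-- An open outer cone near `x` misses `K`, hence also its closure, and contains points `x + t • ν`
arbitrarily close to `x`. -/
theorem IsOuterNormal.notMem_interior_closure {n : ℕ} {K : Set (E n)} {x ν : E n}
    (h : IsOuterNormal K x ν) : x ∉ interior (closure K) := by
  intro hx
  obtain ⟨r, hr, H⟩ := h.2 (1 / 2) (by norm_num)
  let U : Set (E n) := Metric.ball x r ∩ {y | 1 / 2 * ‖y - x‖ < ⟪y - x, ν⟫}
  have hU : IsOpen U := Metric.isOpen_ball.inter (isOpen_lt (by fun_prop) (by fun_prop))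
  have hUK : Disjoint U (closure K) := by
    refine Disjoint.closure_right (disjoint_left.2 fun y hy => ?_) hU
    have hy2 : 1 / 2 * ‖y - x‖ < ⟪y - x, ν⟫ := hy.2
    refine (H y hy.1 ?_).2 hy2.le
    rintro rfl
    simp at hy2
  have hc : Filter.Tendsto (fun t : ℝ => x + t • ν) (nhdsWithin 0 (Ioi 0)) (nhds x) := by
    have : Continuous fun t : ℝ => x + t • ν := by fun_prop
    have h0 := this.tendsto 0
    rw [zero_smul, add_zero] at h0
    exact h0.mono_left nhdsWithin_le_nhds
  obtain ⟨t, ⟨ht1, ht2⟩, ht0⟩ := ((hc.eventually (mem_interior_iff_mem_nhds.1 hx)).and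
    (hc.eventually (Metric.ball_mem_nhds x hr)) |>.and self_mem_nhdsWithin).exists
  refine disjoint_left.1 hUK ⟨ht2, ?_⟩ ht1
  have ht : (0 : ℝ) < t := ht0
  change 1 / 2 * ‖x + t • ν - x‖ < ⟪x + t • ν - x, ν⟫
  rw [add_sub_cancel_left, norm_smul, Real.norm_of_nonneg ht.le, real_inner_smul_left,
    real_inner_self_eq_norm_sq, h.1]
  linarith

/-! ### Interfaces of a partition -/

namespace HybridSpaces

variable {n : ℕ} {ι : Type*} (T : HybridSpaces n ι)

/-- A point at which `Ω` and all elements whose boundary contains it have an outer normal. -/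
def HasNormals (x : E n) : Prop :=
  (∀ i, x ∈ frontier (T.K i) → ∃ ν, IsOuterNormal (T.K i) x ν) ∧
    (x ∈ frontier T.Ω → ∃ ν, IsOuterNormal T.Ω x ν)

theorem ae_hasNormals [Finite ι] : ∀ᵐ x ∂(μHE[n - 1] : Measure (E n)), T.HasNormals x :=
  (ae_all_iff.2 fun i => (T.lipschitz_elem i).ae_exists_isOuterNormal).and
    T.lipschitz.ae_exists_isOuterNormal

variable {T}

theorem mem_frontier_of_mem_closure {i j : ι} (hij : i ≠ j) {x : E n}
    (hi : x ∈ closure (T.K i)) (hj : x ∈ closure (T.K j)) : x ∈ frontier (T.K j) := by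
  rw [(T.lipschitz_elem j).isOpen.frontier_eq]
  exact ⟨hj, fun h => disjoint_left.1
    ((T.disjoint i j hij).closure_left (T.lipschitz_elem j).isOpen) hi h⟩

/-- Three distinct elements do not meet at a point at which they have normals. -/
theorem HasNormals.eq_or_eq {x : E n} (hx : T.HasNormals x) {i j k : ι} (hij : i ≠ j)
    (hi : x ∈ frontier (T.K i)) (hj : x ∈ frontier (T.K j)) (hk : x ∈ frontier (T.K k)) :
    k = i ∨ k = j := by
  by_contra! h
  obtain ⟨ν, hν⟩ := hx.1 i hi
  obtain ⟨μ, hμ⟩ := hx.1 j hj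
  obtain ⟨ξ, hξ⟩ := hx.1 k hk
  have h1 := hν.eq_neg_of_disjoint hμ (T.disjoint i j hij)
  have h2 := hξ.eq_neg_of_disjoint hμ (T.disjoint k j h.2)
  have h3 := hν.eq_neg_of_disjoint hξ (T.disjoint i k h.1.symm)
  -- Three pairwise opposite normals would force `ν = -ν`.
  exact hν.ne_neg (by rw [← h3, ← neg_inj, ← h2, h1])

/-- Two distinct elements do not meet on `∂Ω` at a point at which there are normals. -/
theorem HasNormals.mem_domain {x : E n} (hx : T.HasNormals x) {i j : ι} (hij : i ≠ j)
    (hi : x ∈ frontier (T.K i)) (hj : x ∈ frontier (T.K j)) : x ∈ T.Ω := by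
  by_contra h
  have hΩ : x ∈ frontier T.Ω := by
    rw [T.lipschitz.isOpen.frontier_eq]
    exact ⟨closure_mono (T.subset i) (frontier_subset_closure hi), h⟩
  obtain ⟨ν, hν⟩ := hx.1 i hi
  obtain ⟨μ, hμ⟩ := hx.1 j hj
  obtain ⟨ξ, hξ⟩ := hx.2 hΩ
  have h1 := hν.eq_neg_of_disjoint hμ (T.disjoint i j hij)
  -- The complement of `Ω` plays the role of a third element, with outer normal `-ξ`.
  have h2 := hν.eq_neg_of_disjoint hξ.compl (disjoint_compl_right.mono_left (T.subset i))
  have h3 := hμ.eq_neg_of_disjoint hξ.compl (disjoint_compl_right.mono_left (T.subset j))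
  exact hν.ne_neg (by rw [← h2, h3, h1, neg_neg])

theorem region_eq (𝒦 : Finset ι) : T.region 𝒦 = ⋃ i ∈ 𝒦, closure (T.K i) :=
  𝒦.closure_biUnion _

/-- Up to points without normals, the part of `∂K` that is interior to a region consists of the
interfaces with the other elements of the region. -/
theorem HasNormals.mem_frontier_diff_iff [Finite ι] {x : E n} (hx : T.HasNormals x) {𝒦 : Finset ι}
    {i : ι} (hi : i ∈ 𝒦) : x ∈ frontier (T.K i) \ frontier (T.region 𝒦) ↔
      ∃ j ∈ 𝒦, j ≠ i ∧ x ∈ frontier (T.K i) ∩ frontier (T.K j) := by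
  have hclosed : IsClosed (T.region 𝒦) := isClosed_closure
  have hmem : ∀ k ∈ 𝒦, closure (T.K k) ⊆ T.region 𝒦 := fun k hk => by
    rw [region_eq]
    exact subset_biUnion_of_mem (u := fun k => closure (T.K k)) hk
  have havoid : ∀ s : Set ι, (∀ k ∈ s, x ∉ closure (T.K k)) →
      ∀ᶠ y in nhds x, ∀ k ∈ s, y ∉ closure (T.K k) := fun s hs =>
    (Filter.eventually_all_finite s.toFinite).2 fun k hk =>
      isClosed_closure.isOpen_compl.mem_nhds (hs k hk)
  constructor
  -- If no other element of `𝒦` touched `x`, the region would coincide with `closure (T.K i)` near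
  -- `x`. Then `x` would be interior to that closure, which the normal forbids.
  · rintro ⟨h1, h2⟩
    by_contra! hne
    have hint : x ∈ interior (T.region 𝒦) := by
      by_contra h
      exact h2 (hclosed.frontier_eq ▸ ⟨hmem i hi (frontier_subset_closure h1), h⟩)
    obtain ⟨ν, hν⟩ := hx.1 i h1
    apply hν.notMem_interior_closure
    rw [mem_interior_iff_mem_nhds] at hint ⊢
    filter_upwards [hint, havoid {k | k ∈ 𝒦 ∧ k ≠ i} fun k hk hxk => hne k hk.1 hk.2
      ⟨h1, mem_frontier_of_mem_closure hk.2.symm (frontier_subset_closure h1) hxk⟩] with y hy hy'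
    rw [region_eq, mem_iUnion₂] at hy
    obtain ⟨k, hk, hyk⟩ := hy
    by_cases hki : k = i
    · exact hki ▸ hyk
    · exact absurd hyk (hy' k ⟨hk, hki⟩)
  -- Near `x` only elements `i` and `j` are present and `Ω` is a neighborhood of `x`, so their two
  -- closures already fill a neighborhood.
  · rintro ⟨j, hj, hji, h1, h2⟩
    refine ⟨h1, fun h => ?_⟩
    rw [hclosed.frontier_eq] at h
    apply h.2
    rw [mem_interior_iff_mem_nhds]
    have hΩ := T.lipschitz.isOpen.mem_nhds (hx.mem_domain hji h2 h1)
    filter_upwards [hΩ, havoid {k | k ≠ i ∧ k ≠ j} fun k hk hxk => by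
      have h3 := mem_frontier_of_mem_closure hk.1.symm (frontier_subset_closure h1) hxk
      rcases hx.eq_or_eq hji.symm h1 h2 h3 with h | h
      exacts [hk.1 h, hk.2 h]] with y hy hy'
    have hy2 : y ∈ ⋃ i, closure (T.K i) := T.cover ▸ subset_closure hy
    obtain ⟨k, hyk⟩ := mem_iUnion.1 hy2
    by_cases hki : k = i
    · exact hmem i hi (hki ▸ hyk)
    by_cases hkj : k = j
    · exact hmem j hj (hkj ▸ hyk)
    exact absurd hyk (hy' k ⟨hki, hkj⟩)

end HybridSpaces

/-! ### Algebra of brackets -/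

theorem ip_comm {V : Type*} [NormedAddCommGroup V] [InnerProductSpace ℝ V] (a b : Bold V) :
    ip a b = ip b a := by
  rw [ip, ip, real_inner_comm, real_inner_comm b.2]

theorem ip_zero_right {V : Type*} [NormedAddCommGroup V] [InnerProductSpace ℝ V] (a : Bold V) :
    ip a 0 = 0 := by
  simp [ip]

theorem ip_sub_left {V : Type*} [NormedAddCommGroup V] [InnerProductSpace ℝ V] (a b c : Bold V) :
    ip (a - b) c = ip a c - ip b c := by
  simp only [ip, Prod.fst_sub, Prod.snd_sub, inner_sub_left]; ring

theorem ip_sub_right {V : Type*} [NormedAddCommGroup V] [InnerProductSpace ℝ V] (a b c : Bold V) :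
    ip a (b - c) = ip a b - ip a c := by
  rw [ip_comm, ip_sub_left, ip_comm b, ip_comm c]

theorem ip_J {V : Type*} [NormedAddCommGroup V] [InnerProductSpace ℝ V] (a b : Bold V) :
    ip (J a) b = - ip (J b) a := by
  simp only [ip, J, inner_neg_left]
  rw [real_inner_comm a.2, real_inner_comm b.2]; ring

variable {n : ℕ} {K : Set (E n)}

theorem bracket_swap (a b : BdryTraces K) : bracket b a = - bracket a b := by
  simp only [bracket]; ring

theorem bracket_zero_right (a : BdryTraces K) : bracket a 0 = 0 := by
  rw [bracket, Prod.fst_zero, Prod.snd_zero, ip_zero_right, ip_comm, ip_zero_right, sub_zero]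

theorem bracket_sub_sub (a a' b b' : BdryTraces K) : bracket (a - a') (b - b') =
    bracket a b - bracket a b' - bracket a' b + bracket a' b' := by
  simp only [bracket, Prod.fst_sub, Prod.snd_sub, ip_sub_left, ip_sub_right]
  ring

/-! ### Integration by parts -/

/-- For smooth forms this is the definition of the normal trace. Both sides are continuous in `(w,
a, g)`, so it extends to the closure that defines the tangential trace. -/
theorem HasTanTrace.inner_tan_nor {w a v b : L2 K} {g h : BdryL2 K} (hw : HasTanTrace K w a g)
    (hv : HasNorTrace K v b h) : ⟪g, h⟫ = ⟪a, v⟫ - ⟪w, b⟫ := by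
  let C : Set (L2 K × L2 K × BdryL2 K) := {p | ⟪p.2.2, h⟫ = ⟪p.2.1, v⟫ - ⟪p.1, b⟫}
  have hcl : IsClosed C :=
    isClosed_eq ((continuous_snd.comp continuous_snd).inner continuous_const)
      (((continuous_fst.comp continuous_snd).inner continuous_const).sub
        (continuous_fst.inner continuous_const))
  have hmem : (w, a, g) ∈ closure (smoothTangential K : Set (L2 K × L2 K × BdryL2 K)) := hw.2
  exact closure_minimal (t := C) hv.2 hcl hmem

/-- Antisymmetrizing the integration by parts groups `d` and `δ` into `𝐃`, which is thus symmetric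
up to the boundary bracket. -/
theorem bracket_traces {W : Submodule ℝ (TraceForms K)} (w₁ w₂ : Bold W) :
    bracket (traces w₁) (traces w₂) = ip (dirac w₁) (val w₂) - ip (val w₁) (dirac w₂) := by
  have h : ∀ a b : W, ⟪GraphSpace.tan a.1.1, GraphSpace.nor b.1.1⟫
      = ⟪GraphSpace.d a.1.1, GraphSpace.form b.1.1⟫ - ⟪GraphSpace.form a.1.1, GraphSpace.δ b.1.1⟫ :=
    fun a b => HasTanTrace.inner_tan_nor a.1.2.1 b.1.2.2
  simp only [bracket, traces, ip, dirac, val, h, inner_add_left, inner_add_right]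
  rw [real_inner_comm (GraphSpace.d w₂.1.1.1), real_inner_comm (GraphSpace.δ w₁.1.1.1),
    real_inner_comm (GraphSpace.d w₂.2.1.1), real_inner_comm (GraphSpace.δ w₁.2.1.1)]
  ring

/-! ### The bracket as a boundary integral -/

theorem integrable_inner_bdryL2 (a b : BdryL2 K) :
    Integrable (fun x => ⟪a.1 x, b.1 x⟫) (surface K) :=
  L2.integrable_inner a.1 b.1

theorem integrable_bracketDensity (a b : BdryTraces K) :
    Integrable (bracketDensity a b) (surface K) :=
  ((integrable_inner_bdryL2 _ _).add (integrable_inner_bdryL2 _ _)).sub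
    ((integrable_inner_bdryL2 _ _).add (integrable_inner_bdryL2 _ _))

theorem bracket_eq_integral (a b : BdryTraces K) :
    bracket a b = ∫ x in frontier K, bracketDensity a b x ∂μHE[n - 1] := by
  have h := integral_sub
    ((integrable_inner_bdryL2 a.2.1 b.1.1).add (integrable_inner_bdryL2 a.2.2 b.1.2))
    ((integrable_inner_bdryL2 b.2.1 a.1.1).add (integrable_inner_bdryL2 b.2.2 a.1.2))
  rw [integral_add' (integrable_inner_bdryL2 a.2.1 b.1.1) (integrable_inner_bdryL2 a.2.2 b.1.2),
    integral_add' (integrable_inner_bdryL2 b.2.1 a.1.1) (integrable_inner_bdryL2 b.2.2 a.1.2)] at h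
  exact h.symm

/-- Every term pairs one tangential with one normal trace, so exactly one factor changes sign. -/
theorem bracketDensity_eq_neg {K' : Set (E n)} {a b : BdryTraces K} {a' b' : BdryTraces K'}
    {x : E n} (ha : a.1.1.1 x + a'.1.1.1 x = 0 ∧ a.1.2.1 x + a'.1.2.1 x = 0)
    (hb : b.1.1.1 x + b'.1.1.1 x = 0 ∧ b.1.2.1 x + b'.1.2.1 x = 0)
    (ha' : a.2.1.1 x = a'.2.1.1 x ∧ a.2.2.1 x = a'.2.2.1 x)
    (hb' : b.2.1.1 x = b'.2.1.1 x ∧ b.2.2.1 x = b'.2.2.1 x) :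
    bracketDensity a b x = - bracketDensity a' b' x := by
  rw [bracketDensity, bracketDensity, ha'.1, ha'.2, hb'.1, hb'.2,
    eq_neg_of_add_eq_zero_left ha.1, eq_neg_of_add_eq_zero_left ha.2,
    eq_neg_of_add_eq_zero_left hb.1, eq_neg_of_add_eq_zero_left hb.2,
    inner_neg_right, inner_neg_right, inner_neg_right, inner_neg_right]
  ring

/-! ### The local conservation law -/

theorem hasDerivWithinAt_ip {V : Type*} [NormedAddCommGroup V] [InnerProductSpace ℝ V]
    {a b : ℝ → Bold V} {a' b' : Bold V} {I : Set ℝ} {t : ℝ}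
    (ha : HasDerivWithinAt a a' I t) (hb : HasDerivWithinAt b b' I t) :
    HasDerivWithinAt (fun τ => ip (J (a τ)) (b τ)) (ip (J a') (b t) + ip (J (a t)) b') I t := by
  have ha1 := (ContinuousLinearMap.fst ℝ V V).hasFDerivAt.comp_hasDerivWithinAt t ha
  have ha2 := (ContinuousLinearMap.snd ℝ V V).hasFDerivAt.comp_hasDerivWithinAt t ha
  have hb1 := (ContinuousLinearMap.fst ℝ V V).hasFDerivAt.comp_hasDerivWithinAt t hb
  have hb2 := (ContinuousLinearMap.snd ℝ V V).hasFDerivAt.comp_hasDerivWithinAt t hb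
  have h := (ha2.neg.inner ℝ hb1).add (ha1.inner ℝ hb2)
  refine h.congr_deriv ?_
  change ⟪-(a t).2, b'.1⟫ + ⟪-a'.2, (b t).1⟫ + (⟪(a t).1, b'.2⟫ + ⟪a'.1, (b t).2⟫) =
    ⟪-a'.2, (b t).1⟫ + ⟪a'.1, (b t).2⟫ + (⟪-(a t).2, b'.1⟫ + ⟪(a t).1, b'.2⟫)
  ring

namespace HybridSpaces

variable {ι : Type*} {T : HybridSpaces n ι}

/-- The space `𝐖_h` is a product, so test functions supported on a single element are admissible. -/
theorem DynEq.elem [Fintype ι] {s : T.State} {w' F : ∀ i, Bold (L2 (T.K i))} (h : DynEq s w' F)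
    (i : ι) (v : Bold (T.W i)) :
    ip (J (w' i)) (val v) + ip (val (s.form i)) (dirac v) + bracket (s.hat i) (traces v)
      = ip (F i) (val v) := by
  classical
  have h0 := h (Function.update 0 i v)
  have hv : ∀ j, j ≠ i → val ((Function.update 0 i v : T.BW) j) = 0 := fun j hj => by
    rw [Function.update_of_ne hj]
    simp [val, map_zero]
  have hd : ∀ j, j ≠ i → dirac ((Function.update 0 i v : T.BW) j) = 0 := fun j hj => by
    rw [Function.update_of_ne hj]
    simp [dirac, map_zero]
  have ht : ∀ j, j ≠ i → traces ((Function.update 0 i v : T.BW) j) = 0 := fun j hj => by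
    rw [Function.update_of_ne hj]
    simp [traces, map_zero]
  rw [Fintype.sum_eq_single i fun j hj => by rw [hv j hj, ip_zero_right],
    Fintype.sum_eq_single i fun j hj => by rw [hd j hj, ip_zero_right],
    Fintype.sum_eq_single i fun j hj => by rw [ht j hj, bracket_zero_right],
    Fintype.sum_eq_single i fun j hj => by rw [hv j hj, ip_zero_right],
    Function.update_self] at h0
  exact h0

/-- The multisymplectic conservation law on a single element. -/
theorem hasDerivWithinAt_elem [Fintype ι] {I : Set ℝ} {f : T.Source} {Φ : T.Flux}
    (hms : FluxMultisymplectic Φ) {z w₁ w₂ : ℝ → T.State} (hsym : SymmetricAlong I f z)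
    (h₁ : IsFirstVariation I f Φ z w₁) (h₂ : IsFirstVariation I f Φ z w₂) (i : ι) {t : ℝ}
    (ht : t ∈ I) :
    HasDerivWithinAt (fun τ => ip (J (val ((w₁ τ).form i))) (val ((w₂ τ).form i)))
      (- bracket ((w₁ t).hat i) ((w₂ t).hat i)) I t := by
  obtain ⟨⟨w₁', hd₁, hdyn₁⟩, hflux₁, -⟩ := h₁ t ht
  obtain ⟨⟨w₂', hd₂, hdyn₂⟩, hflux₂, -⟩ := h₂ t ht
  refine (hasDerivWithinAt_ip (hd₁ i) (hd₂ i)).congr_deriv ?_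
  have e₁ := hdyn₁.elem i ((w₂ t).form i)
  have e₂ := hdyn₂.elem i ((w₁ t).form i)
  have e₃ := hsym t ht i ((w₁ t).form i) ((w₂ t).form i)
  have e₄ := bracket_traces ((w₁ t).form i) ((w₂ t).form i)
  have e₅ := hms (w₁ t) (w₂ t) hflux₁ hflux₂ i
  rw [bracket_sub_sub, bracket_swap ((w₂ t).hat i) (traces ((w₁ t).form i))] at e₅
  rw [ip_comm (val ((w₂ t).form i)), ip_comm _ (val ((w₁ t).form i))] at e₂
  rw [ip_J (val ((w₁ t).form i)), ip_comm (J (w₂' i))]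
  rw [ip_comm (val ((w₁ t).form i))] at e₃
  beta_reduce at e₁ e₂
  linarith

/-! ### Summation over a collection of elements -/

/-- On an interface, the densities of the bracket from the two sides cancel. -/
theorem ae_bracketDensity_add {s₁ s₂ : T.State} (h₁ : T.NorSingleValued s₁.nor)
    (h₂ : T.NorSingleValued s₂.nor) {i j : ι} (hij : i ≠ j) :
    ∀ᵐ x ∂(T.facet i j), bracketDensity (s₁.hat i) (s₂.hat i) x
      = - bracketDensity (s₁.hat j) (s₂.hat j) x := by
  filter_upwards [h₁ i j hij, h₂ i j hij, s₁.single i j hij, s₂.single i j hij]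
    with x n₁ n₂ t₁ t₂
  exact bracketDensity_eq_neg n₁ n₂ t₁ t₂

open Classical in
/-- The part of the bracket on `∂K` that is interior to a region is the sum over the interfaces. -/
theorem integral_frontier_diff [Finite ι] (𝒦 : Finset ι) {i : ι} (hi : i ∈ 𝒦) {g : E n → ℝ}
    (hg : IntegrableOn g (frontier (T.K i)) μHE[n - 1]) :
    ∫ x in frontier (T.K i) \ frontier (T.region 𝒦), g x ∂μHE[n - 1]
      = ∑ j ∈ 𝒦.erase i, ∫ x, g x ∂(T.facet i j) := by
  have hae : (frontier (T.K i) \ frontier (T.region 𝒦) : Set (E n)) =ᵐ[μHE[n - 1]]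
      ⋃ j : 𝒦.erase i, frontier (T.K i) ∩ frontier (T.K j) := by
    filter_upwards [T.ae_hasNormals] with x hx
    refine propext ((hx.mem_frontier_diff_iff hi).trans ?_)
    change _ ↔ x ∈ ⋃ j : 𝒦.erase i, frontier (T.K i) ∩ frontier (T.K j)
    rw [mem_iUnion]
    constructor
    · rintro ⟨j, hj, hji, hxj⟩
      exact ⟨⟨j, Finset.mem_erase.2 ⟨hji, hj⟩⟩, hxj⟩
    · rintro ⟨⟨j, hj⟩, hxj⟩
      exact ⟨j, Finset.mem_of_mem_erase hj, Finset.ne_of_mem_erase hj, hxj⟩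
  rw [setIntegral_congr_set hae, integral_iUnion_ae, tsum_fintype]
  · exact Finset.sum_coe_sort (𝒦.erase i) fun j => ∫ x, g x ∂(T.facet i j)
  · exact fun j => (isClosed_frontier.inter isClosed_frontier).nullMeasurableSet
  · intro j k hjk
    -- Two different interfaces of `K i` overlap only where three elements meet, which is a null
    -- set.
    refine measure_eq_zero_iff_ae_notMem.2 ?_
    filter_upwards [T.ae_hasNormals] with x hx hxjk
    rcases hx.eq_or_eq (Finset.ne_of_mem_erase j.2).symm hxjk.1.1 hxjk.1.2 hxjk.2.2 with h | h
    · exact Finset.ne_of_mem_erase k.2 h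
    · exact hjk (Subtype.ext h.symm)
  · exact hg.mono_set (iUnion_subset fun j => inter_subset_left)

/-- Each `∂K` splits into its part on the boundary of the region and its interfaces inside the
region; the latter contribute nothing in total. -/
theorem sum_bracket_eq_regionBracket [Finite ι] (𝒦 : Finset ι) {s₁ s₂ : T.State}
    (h₁ : T.NorSingleValued s₁.nor) (h₂ : T.NorSingleValued s₂.nor) :
    ∑ i ∈ 𝒦, bracket (s₁.hat i) (s₂.hat i) = regionBracket 𝒦 s₁ s₂ := by
  classical
  set g : ι → E n → ℝ := fun i => bracketDensity (s₁.hat i) (s₂.hat i)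
  have hg : ∀ i, IntegrableOn (g i) (frontier (T.K i)) μHE[n - 1] := fun i =>
    integrable_bracketDensity _ _
  have hsplit : ∀ i ∈ 𝒦, bracket (s₁.hat i) (s₂.hat i) =
      ∫ x in frontier (T.region 𝒦) ∩ frontier (T.K i), g i x ∂μHE[n - 1]
        + ∑ j ∈ 𝒦 with j ≠ i, ∫ x, g i x ∂(T.facet i j) := fun i hi => by
    rw [bracket_eq_integral, ← integral_inter_add_sdiff isClosed_frontier.measurableSet (hg i),
      integral_frontier_diff 𝒦 hi (hg i), inter_comm, Finset.filter_ne']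
  have hanti : ∀ i j, j ≠ i →
      ∫ x, g i x ∂(T.facet i j) = - ∫ x, g j x ∂(T.facet j i) := fun i j hij => by
    have hf : T.facet j i = T.facet i j := by rw [facet, facet, inter_comm]
    rw [hf, ← integral_neg]
    exact integral_congr_ae (ae_bracketDensity_add h₁ h₂ hij.symm)
  have hzero : ∑ i ∈ 𝒦, ∑ j ∈ 𝒦 with j ≠ i, ∫ x, g i x ∂(T.facet i j) = 0 := by
    -- Exchanging `i` and `j` negates every summand, so the double sum equals its own negative.
    refine self_eq_neg.1 ?_
    simp only [Finset.sum_filter]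
    conv_lhs => rw [Finset.sum_comm]
    rw [← Finset.sum_neg_distrib]
    refine Finset.sum_congr rfl fun j _ => ?_
    rw [← Finset.sum_neg_distrib]
    refine Finset.sum_congr rfl fun i _ => ?_
    by_cases h : i = j
    · simp [h]
    · rw [if_pos h, if_pos (Ne.symm h), hanti i j (Ne.symm h)]
  rw [Finset.sum_congr rfl hsplit, Finset.sum_add_distrib, hzero, add_zero, regionBracket]

end HybridSpaces

end FEEC

theorem mainTheorem6 {n : ℕ} {ι : Type*} [Fintype ι] (T : FEEC.HybridSpaces n ι)
    (I : Set ℝ) (hI : I.OrdConnected) (hI' : I.Nontrivial)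
    (f : T.Source) (hf : ∀ i, ∀ t ∈ I, ContDiff ℝ 1 (f i t))
    (Φ : T.Flux) (hcons : FEEC.HybridSpaces.StronglyConservative Φ)
    (hms : FEEC.HybridSpaces.FluxMultisymplectic Φ) :
    FEEC.HybridSpaces.StronglyMultisymplectic I f Φ := by
  intro z w₁ w₂ _ hsym h₁ h₂ 𝒦 t ht
  -- The flux and conservativity equations do not involve the source, so first variations satisfy
  -- them unchanged and strong conservativity applies to them.
  rw [← FEEC.HybridSpaces.sum_bracket_eq_regionBracket 𝒦
    (hcons _ (h₁ t ht).2.1 (h₁ t ht).2.2) (hcons _ (h₂ t ht).2.1 (h₂ t ht).2.2),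
    ← Finset.sum_neg_distrib]
  exact HasDerivWithinAt.fun_sum fun i _ =>
    FEEC.HybridSpaces.hasDerivWithinAt_elem hms hsym h₁ h₂ i ht
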